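/- Three-player problem. Let $x(k)$, $u(k)$, $y(k)$ ($k=0,1,2,\dots$) be real vectors split into three blocks of dimensions $n_i$, $q_i$, $p_i$ ($i=1,2,3$), with $$x(k+1)=Ax(k)+Bu(k)+w(k),\qquad y(k)=Cx(k)+v(k),$$ where $A=[A_{ij}]$ satisfies $A_{12}=A_{23}=A_{31}=0$, and $B$, $C$ are block diagonal. The initial state $x(0)$ has mean zero and covariance $P_0$; $w$ and $v$ are zero-mean white noises with covariance matrices $W$ and $V$; $x(0)$, $w$, $v$ are jointly Gaussian and mutually uncorrelated; $V$ is positive definite. The control is $$u(k)=F(k)y(k)+G(k)y(k-1)+f_k\bigl(y(0:k-2)\bigr),$$ where $y(0:m)$ stands for $y(0),\dots,y(m)$ (empty if $m<0$), $F(k)$ is block diagonal, $G(k)=[G_{ij}(k)]$ satisfies $G_{12}(k)=G_{23}(k)=G_{31}(k)=0$, $f_k$ is linear, and terms with a negative time are absent. Define $\hat x(k|k-1)=\mathbf E\{x(k)\mid y(0:k-1)\}$, $\tilde y(k)=y(k)-C\hat x(k|k-1)$ and $P(k)=\mathbf E\{(x(k)-\hat x(k|k-1))(x(k)-\hat x(k|k-1))^T\}$.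 Let $S_1=\{1,3\}$, $S_2=\{1,2\}$, $S_3=\{2,3\}$, $S_t=\{1,2,3\}$. Let $\hat x^{[1]}(k)$ be the vector with blocks $\hat x^{[1]}_i(k)=\mathbf E\{x_i(k)\mid y(0:k-2),\ y_j(k-1),\ j\in S_i\}$, and let $e^{[1]}(k)=x(k)-\hat x^{[1]}(k)$. Let $K^{[1]}(k)=[K^{[1]}_{ij}(k)]$ be the block matrix with $K^{[1]}_{ij}(k)=0$ for $j\notin S_i$ and $$\bigl[K^{[1]}_{ij}(k)\bigr]_{j\in S_i}=[A]_i\,[P(k)]_{S_tS_i}[C]_{S_iS_i}^T\bigl([C]_{S_iS_i}[P(k)]_{S_iS_i}[C]_{S_iS_i}^T+[V]_{S_iS_i}\bigr)^{-1},$$ where $[A]_i$ is the $i$-th block row of $A$ and $[M]_{SS'}$ is the submatrix of $M$ with block rows in $S$ and block columns in $S'$. Then for every $k\ge 0$ the vector $x(k)$ is square integrable and, almost surely, $$x(k)=\tilde x(k)+\hat x(k),$$ where the random vectors $\tilde x(k)$ and $\hat x(k)$ are independent and given by $$\hat x(k)=\mathbf E\{x(k)\mid y(0:k-2)\},\qquad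 \tilde x(k)=e^{[1]}(k)+\bigl(BF(k-1)+K^{[1]}(k-1)\bigr)\tilde y(k-1);$$ for $k=0$ the second term of $\tilde x(k)$ is absent. -/

import Mathlib

open MeasureTheory ProbabilityTheory
open scoped Matrix

namespace ThreePlayer

/-- Index set of a vector in `ℝ^{d₁} × ℝ^{d₂} × ℝ^{d₃}`, one block for each of the three players
(numbered `0, 1, 2`). -/
abbrev Idx (d : Fin 3 → ℕ) : Type := Σ i : Fin 3, Fin (d i)

/-- `S i`: the players (with `i` itself) that influence player `i` in one time step, and whose
measurements reach player `i` with a delay of at most one step.  In the numbering `1, 2, 3` these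
are `S₁ = {1, 3}`, `S₂ = {1, 2}`, `S₃ = {2, 3}`. -/
def S : Fin 3 → Finset (Fin 3) := ![{0, 2}, {0, 1}, {1, 2}]

/-- The indices in the blocks of the players in `S i`. -/
abbrev NIdx (d : Fin 3 → ℕ) (i : Fin 3) : Type := {b : Idx d // b.1 ∈ S i}

/-- The matrix has the block sparsity pattern `[* 0 *; * * 0; 0 * *]`. -/
def IsSparse {r c : Fin 3 → ℕ} (M : Matrix (Idx r) (Idx c) ℝ) : Prop :=
  ∀ a b, b.1 ∉ S a.1 → M a b = 0

/-- The matrix is block diagonal. -/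
def IsBlockDiag {r c : Fin 3 → ℕ} (M : Matrix (Idx r) (Idx c) ℝ) : Prop :=
  ∀ a b, b.1 ≠ a.1 → M a b = 0

/-- The data of the three-player system: `n i`, `q i`, `p i` are the dimensions of the state, the
control and the measurement of player `i`; `W`, `V`, `P₀` are the covariances of the process noise,
the measurement noise and the initial state. -/
structure Plant (n q p : Fin 3 → ℕ) where
  A : Matrix (Idx n) (Idx n) ℝ
  B : Matrix (Idx n) (Idx q) ℝ
  C : Matrix (Idx p) (Idx n) ℝ
  W : Matrix (Idx n) (Idx n) ℝ
  V : Matrix (Idx p) (Idx p) ℝ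
  P₀ : Matrix (Idx n) (Idx n) ℝ
  sparse_A : IsSparse A
  diag_B : IsBlockDiag B
  diag_C : IsBlockDiag C
  posDef_V : V.PosDef

/-- A linear control law `u(k) = F(k) y(k) + G(k) y(k-1) + f_k(y(0:k-2))` that complies with the
information structure.  The list `y(0:k-2)` has `k - 1` entries (none for `k = 0, 1`). -/
structure Controller (q p : Fin 3 → ℕ) where
  F : ℕ → Matrix (Idx q) (Idx p) ℝ
  G : ℕ → Matrix (Idx q) (Idx p) ℝ
  f : (k : ℕ) → ((Fin (k - 1) → Idx p → ℝ) →ₗ[ℝ] (Idx q → ℝ))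
  diag_F : ∀ k, IsBlockDiag (F k)
  sparse_G : ∀ k, IsSparse (G k)

/-- The sequence delayed by one step, `k ↦ z(k-1)`, with `z(-1) = 0`. -/
def delay {α : Type*} [Zero α] (z : ℕ → α) : ℕ → α
  | 0 => 0
  | k + 1 => z k

variable {Ω : Type*} {n q p : Fin 3 → ℕ}

/-- All scalar random variables that drive the system: the entries of `x(0)`, of `w(k)` and of
`v(k)`, `k ∈ ℕ`, as one family. -/
def primitives (x₀ : Ω → Idx n → ℝ) (w : ℕ → Ω → Idx n → ℝ) (v : ℕ → Ω → Idx p → ℝ) :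
    Idx n ⊕ (ℕ × Idx n) ⊕ (ℕ × Idx p) → Ω → ℝ
  | .inl a => fun ω => x₀ ω a
  | .inr (.inl (k, a)) => fun ω => w k ω a
  | .inr (.inr (k, b)) => fun ω => v k ω b

/-- The closed-loop system: `x(k+1) = A x(k) + B u(k) + w(k)`, `y(k) = C x(k) + v(k)`, with `u` given
by the control law, `x(0) ∼ N(0, P₀)`, and `w`, `v` Gaussian white noises with covariances `W`, `V`,
uncorrelated with each other and with `x(0)`. -/
structure IsClosedLoop [MeasurableSpace Ω] (μ : Measure Ω) (sys : Plant n q p) (Γ : Controller q p)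
    (x : ℕ → Ω → Idx n → ℝ) (u : ℕ → Ω → Idx q → ℝ) (y : ℕ → Ω → Idx p → ℝ)
    (w : ℕ → Ω → Idx n → ℝ) (v : ℕ → Ω → Idx p → ℝ) : Prop where
  state : ∀ k ω, x (k + 1) ω = sys.A *ᵥ x k ω + sys.B *ᵥ u k ω + w k ω
  output : ∀ k ω, y k ω = sys.C *ᵥ x k ω + v k ω
  control : ∀ k ω, u k ω =
    Γ.F k *ᵥ y k ω + Γ.G k *ᵥ delay y k ω + Γ.f k (fun j : Fin (k - 1) => y j ω)
  measurable_x₀ : Measurable (x 0)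
  measurable_w : ∀ k, Measurable (w k)
  measurable_v : ∀ k, Measurable (v k)
  gaussian : IsGaussianProcess (primitives (x 0) w v) μ
  mean_zero : ∀ t, ∫ ω, primitives (x 0) w v t ω ∂μ = 0
  cov_x₀ : ∀ a b, ∫ ω, x 0 ω a * x 0 ω b ∂μ = sys.P₀ a b
  cov_w : ∀ k l a b, ∫ ω, w k ω a * w l ω b ∂μ = if k = l then sys.W a b else 0
  cov_v : ∀ k l a b, ∫ ω, v k ω a * v l ω b ∂μ = if k = l then sys.V a b else 0
  cov_wv : ∀ k l a b, ∫ ω, w k ω a * v l ω b ∂μ = 0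
  cov_x₀w : ∀ k a b, ∫ ω, x 0 ω a * w k ω b ∂μ = 0
  cov_x₀v : ∀ k a b, ∫ ω, x 0 ω a * v k ω b ∂μ = 0

/-- The σ-algebra generated by the first `m` measurements `y(0), …, y(m-1)`. -/
@[reducible] def past (y : ℕ → Ω → Idx p → ℝ) (m : ℕ) : MeasurableSpace Ω :=
  ⨆ t, ⨆ (_ : t < m), MeasurableSpace.comap (y t) inferInstance

/-- The σ-algebra generated by the measurements up to time `k - 1` that player `i` has at time `k`:
`y_j(k-1)` for `j ∈ S i` (none if `k = 0`), and `y(0:k-2)`. -/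
@[reducible] def info (y : ℕ → Ω → Idx p → ℝ) (i : Fin 3) (k : ℕ) : MeasurableSpace Ω :=
  past y (k - 1) ⊔
    ⨆ j ∈ S i, ⨆ t, ⨆ (_ : t + 1 = k),
      MeasurableSpace.comap (fun ω => fun b : Fin (p j) => y t ω ⟨j, b⟩) inferInstance

variable [MeasurableSpace Ω]

/-- The one-step prediction `x̂(k|k-1) = E{x(k) | y(0:k-1)}`. -/
noncomputable def pred (μ : Measure Ω) (x : ℕ → Ω → Idx n → ℝ) (y : ℕ → Ω → Idx p → ℝ) (k : ℕ) :
    Ω → Idx n → ℝ :=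
  μ[x k | past y k]

/-- The covariance `P(k) = E{e(k) e(k)ᵀ}` of the prediction error `e(k) = x(k) - x̂(k|k-1)`. -/
noncomputable def errCov (μ : Measure Ω) (x : ℕ → Ω → Idx n → ℝ) (y : ℕ → Ω → Idx p → ℝ) (k : ℕ) :
    Matrix (Idx n) (Idx n) ℝ :=
  Matrix.of fun a b => ∫ ω, (x k ω a - pred μ x y k ω a) * (x k ω b - pred μ x y k ω b) ∂μ

/-- The innovation `ỹ(k) = y(k) - C x̂(k|k-1)`. -/
noncomputable def innov (sys : Plant n q p) (μ : Measure Ω) (x : ℕ → Ω → Idx n → ℝ)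
    (y : ℕ → Ω → Idx p → ℝ) (k : ℕ) : Ω → Idx p → ℝ :=
  fun ω => y k ω - sys.C *ᵥ pred μ x y k ω

/-- The local estimate `x̂^{[1]}(k)`: its block `i` is the conditional expectation of `x_i(k)` given
the measurements up to time `k - 1` that player `i` has at time `k`. -/
noncomputable def localEst (μ : Measure Ω) (x : ℕ → Ω → Idx n → ℝ) (y : ℕ → Ω → Idx p → ℝ) (k : ℕ) :
    Ω → Idx n → ℝ :=
  fun ω a => (μ[fun ω' => fun r : Fin (n a.1) => x k ω' ⟨a.1, r⟩ | info y a.1 k]) ω a.2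

/-- The local estimation error `e^{[1]}(k) = x(k) - x̂^{[1]}(k)`. -/
noncomputable def localErr (μ : Measure Ω) (x : ℕ → Ω → Idx n → ℝ) (y : ℕ → Ω → Idx p → ℝ) (k : ℕ) :
    Ω → Idx n → ℝ :=
  fun ω => x k ω - localEst μ x y k ω

/-- The nonzero part of block row `i` of `K^{[1]}`, as a function of the error covariance `P`:
`[A]_i [P]_{S_t S_i} [C]_{S_i S_i}ᵀ ([C]_{S_i S_i} [P]_{S_i S_i} [C]_{S_i S_i}ᵀ + [V]_{S_i S_i})⁻¹`,
where `S_t` is the set of all players. -/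
noncomputable def gainRow (sys : Plant n q p) (P : Matrix (Idx n) (Idx n) ℝ) (i : Fin 3) :
    Matrix (Fin (n i)) (NIdx p i) ℝ :=
  let Ai : Matrix (Fin (n i)) (Idx n) ℝ := sys.A.submatrix (fun r => ⟨i, r⟩) id
  let Pt : Matrix (Idx n) (NIdx n i) ℝ := P.submatrix id Subtype.val
  let Ps : Matrix (NIdx n i) (NIdx n i) ℝ := P.submatrix Subtype.val Subtype.val
  let Cs : Matrix (NIdx p i) (NIdx n i) ℝ := sys.C.submatrix Subtype.val Subtype.val
  let Vs : Matrix (NIdx p i) (NIdx p i) ℝ := sys.V.submatrix Subtype.val Subtype.val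
  Ai * Pt * Csᵀ * (Cs * Ps * Csᵀ + Vs)⁻¹

/-- The gain `K^{[1]}(k)`, with zero blocks outside the pattern `[* 0 *; * * 0; 0 * *]`. -/
noncomputable def localGain (sys : Plant n q p) (μ : Measure Ω) (x : ℕ → Ω → Idx n → ℝ)
    (y : ℕ → Ω → Idx p → ℝ) (k : ℕ) : Matrix (Idx n) (Idx p) ℝ :=
  Matrix.of fun a b =>
    if h : b.1 ∈ S a.1 then gainRow sys (errCov μ x y k) a.1 a.2 ⟨b, h⟩ else 0

/-- `x̂(k) = E{x(k) | y(0:k-2)}`. -/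
noncomputable def xHat (μ : Measure Ω) (x : ℕ → Ω → Idx n → ℝ) (y : ℕ → Ω → Idx p → ℝ) (k : ℕ) :
    Ω → Idx n → ℝ :=
  μ[x k | past y (k - 1)]

/-- `x̃(k) = e^{[1]}(k) + (B F(k-1) + K^{[1]}(k-1)) ỹ(k-1)`; the second term is absent for `k = 0`. -/
noncomputable def xTilde (sys : Plant n q p) (Γ : Controller q p) (μ : Measure Ω)
    (x : ℕ → Ω → Idx n → ℝ) (y : ℕ → Ω → Idx p → ℝ) : ℕ → Ω → Idx n → ℝ
  | 0 => localErr μ x y 0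
  | k + 1 => fun ω =>
      localErr μ x y (k + 1) ω +
        (sys.B * Γ.F k + localGain sys μ x y k) *ᵥ innov sys μ x y k ω

end ThreePlayer

/-! The closed loop is linear and causal, so every variable lies in the linear span of `x(0)`, `w`,
`v`, a centered Gaussian space. There uncorrelated families are independent, and conditional
expectations given finitely many members are orthogonal projections (`condExp_ae_eq`,
`exists_linear_estimate`). The theorem thus becomes second-moment algebra.

Let `ℓ` be the linear version of `x̂(k|k-1)`, `e = x(k) - ℓ`, and `η = y(k) - Cℓ = Ce + v(k)`.
Replacing `x(k)`, `y(k)`, `w(k)` by `ℓ`, `Cℓ`, `0` in the dynamics gives a linear function `xh` of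
`y(0:k-1)` with `x(k+1) - xh = Ae + BFη + w(k)`. This error is uncorrelated with `y(0:k-1)`, so `xh`
is `x̂(k+1)`. Put `ρ = Ae + w(k) - Kη` with `K` the local gain. The normal equations
(`gainRow_normal_equation`) make block `i` of `ρ` uncorrelated with `η_j`, `j ∈ S i`. Since `BF + K`
has the sparsity pattern of `S`, block `i` of `xh + (BF + K)η` uses only what player `i` knows.
Hence it is the local estimate and `ρ` its error, so `x̃(k+1) = ρ + (BF + K)η = x(k+1) - xh`.
Independence follows from the vanishing correlation (`exists_linear_xHat_succ`, `indepFun`). -/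

/-! ### Centered Gaussian spaces: independence, linear estimation, cross-covariances. -/

section Gaussian

variable {Ω : Type*} {m : MeasurableSpace Ω} [MeasurableSpace Ω]

/-- A linear space of random variables whose members are centered and jointly Gaussian. -/
structure IsCenteredGaussianSpace (H : Submodule ℝ (Ω → ℝ)) (μ : Measure Ω) : Prop where
  measurable : ∀ X ∈ H, Measurable X
  integral_eq_zero : ∀ X ∈ H, ∫ ω, X ω ∂μ = 0
  isGaussianProcess : IsGaussianProcess (fun X : H => (X : Ω → ℝ)) μ

/-- The matrix `E{X Yᵀ}`. -/
noncomputable def crossCov {I J : Type*} (μ : Measure Ω) (X : Ω → I → ℝ) (Y : Ω → J → ℝ) :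
    Matrix I J ℝ :=
  Matrix.of fun a b => ∫ ω, X ω a * Y ω b ∂μ

theorem crossCov_transpose {I J : Type*} {μ : Measure Ω} (X : Ω → I → ℝ) (Y : Ω → J → ℝ) :
    (crossCov μ X Y)ᵀ = crossCov μ Y X := by
  ext a b
  simp [crossCov, mul_comm]

namespace IsCenteredGaussianSpace

variable {H : Submodule ℝ (Ω → ℝ)} {μ : Measure Ω}

theorem span_range {T : Type*} {Z : T → Ω → ℝ} (hZ : IsGaussianProcess Z μ)
    (hm : ∀ t, Measurable (Z t)) (h0 : ∀ t, ∫ ω, Z t ω ∂μ = 0) :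
    IsCenteredGaussianSpace (Submodule.span ℝ (Set.range Z)) μ where
  measurable X hX := by
    induction hX using Submodule.span_induction with
    | mem x h => obtain ⟨t, rfl⟩ := h; exact hm t
    | zero => exact measurable_const
    | add x y _ _ hx hy => exact hx.add hy
    | smul a x _ hx => exact hx.const_smul a
  integral_eq_zero X hX := by
    -- Integrability is carried through the induction because the integral is additive only on
    -- integrable functions.
    suffices Integrable X μ ∧ ∫ ω, X ω ∂μ = 0 from this.2
    induction hX using Submodule.span_induction with
    | mem x h => obtain ⟨t, rfl⟩ := h; exact ⟨(hZ.hasGaussianLaw_eval t).integrable, h0 t⟩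
    | zero => exact ⟨integrable_zero _ _ _, by simp⟩
    | add x y _ _ hx hy =>
      exact ⟨hx.1.add hy.1, by simp [integral_add hx.1 hy.1, hx.2, hy.2]⟩
    | smul a x _ hx => exact ⟨hx.1.smul a, by simp [integral_const_mul, hx.2]⟩
  isGaussianProcess := by
    -- Each member of the span is a continuous linear function of finitely many `Z t`.
    refine hZ.of_isGaussianProcess fun X => ?_
    obtain ⟨c, hc⟩ := (Finsupp.mem_span_range_iff_exists_finsupp).1 X.2
    refine ⟨c.support, ∑ t : c.support, c t • ContinuousLinearMap.proj t, fun ω => ?_⟩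
    rw [← hc, Finsupp.sum, ← Finset.sum_coe_sort]
    simp

theorem memLp (hH : IsCenteredGaussianSpace H μ) {X : Ω → ℝ} (hX : X ∈ H) : MemLp X 2 μ :=
  (hH.isGaussianProcess.hasGaussianLaw_eval ⟨X, hX⟩).memLp_two

theorem integrable (hH : IsCenteredGaussianSpace H μ) {X : Ω → ℝ} (hX : X ∈ H) :
    Integrable X μ :=
  have := hH.isGaussianProcess.isProbabilityMeasure
  (hH.memLp hX).integrable one_le_two

theorem integrable_mul (hH : IsCenteredGaussianSpace H μ) {X Y : Ω → ℝ} (hX : X ∈ H)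
    (hY : Y ∈ H) : Integrable (fun ω => X ω * Y ω) μ :=
  (hH.memLp hX).integrable_mul (hH.memLp hY)

/-- Uncorrelated families in a centered Gaussian space are independent. -/
theorem indepFun (hH : IsCenteredGaussianSpace H μ) {I J : Type*} {X : Ω → I → ℝ}
    {Y : Ω → J → ℝ} (hX : ∀ a, (fun ω => X ω a) ∈ H) (hY : ∀ b, (fun ω => Y ω b) ∈ H)
    (hXY : ∀ a b, ∫ ω, X ω a * Y ω b ∂μ = 0) : IndepFun X Y μ := by
  have := hH.isGaussianProcess.isProbabilityMeasure
  refine IsGaussianProcess.indepFun_of_covariance_eq_zero (X := fun a ω => X ω a)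
    (Y := fun b ω => Y ω b) ?_ (fun a => (hH.measurable _ (hX a)).aemeasurable)
    (fun b => (hH.measurable _ (hY b)).aemeasurable) fun a b => ?_
  · have := hH.isGaussianProcess.comp_right
      (Sum.elim (fun a => (⟨_, hX a⟩ : H)) (fun b => (⟨_, hY b⟩ : H)))
    have he : Sum.elim (fun a ω => X ω a) (fun b ω => Y ω b) = (fun Z : H => (Z : Ω → ℝ)) ∘
        Sum.elim (fun a => (⟨_, hX a⟩ : H)) (fun b => (⟨_, hY b⟩ : H)) := by
      ext (a | b) ω <;> rfl
    rwa [he]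
  · rw [covariance_eq_sub (hH.memLp (hX a)) (hH.memLp (hY b)), hH.integral_eq_zero _ (hX a)]
    simpa using hXY a b

/-- The random variables uncorrelated with `X` form a linear space. -/
theorem integral_mul_eq_zero_of_mem_span (hH : IsCenteredGaussianSpace H μ) {X : Ω → ℝ}
    (hX : X ∈ H) {s : Set (Ω → ℝ)} (hs : s ⊆ H) (h0 : ∀ Y ∈ s, ∫ ω, X ω * Y ω ∂μ = 0)
    {Y : Ω → ℝ} (hY : Y ∈ Submodule.span ℝ s) : ∫ ω, X ω * Y ω ∂μ = 0 := by
  suffices Integrable (fun ω => X ω * Y ω) μ ∧ ∫ ω, X ω * Y ω ∂μ = 0 from this.2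
  induction hY using Submodule.span_induction with
  | mem x h => exact ⟨hH.integrable_mul hX (hs h), h0 x h⟩
  | zero => simp
  | add x y _ _ hx hy =>
    simp only [Pi.add_apply, mul_add]
    exact ⟨hx.1.add hy.1, by rw [integral_add hx.1 hy.1, hx.2, hy.2, add_zero]⟩
  | smul a x _ hx =>
    simp only [Pi.smul_apply, smul_eq_mul, mul_left_comm _ a]
    exact ⟨hx.1.const_mul a, by rw [integral_const_mul, hx.2, mul_zero]⟩

/-- If the residual `X - L` is uncorrelated with the observations `Y` and `L` is linear in `Y`, then
`L = E{X | Y}`. -/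
theorem condExp_ae_eq (hH : IsCenteredGaussianSpace H μ) {κ : Type*} {Y : κ → Ω → ℝ}
    (hY : ∀ j, Y j ∈ H) {X L : Ω → ℝ} (hX : X ∈ H) (hL : L ∈ Submodule.span ℝ (Set.range Y))
    (h0 : ∀ j, ∫ ω, (X ω - L ω) * Y j ω ∂μ = 0)
    (hYm : ∀ j, Measurable[m] (Y j))
    (hm : m ≤ MeasurableSpace.comap (fun ω j => Y j ω) MeasurableSpace.pi) :
    μ[X | m] =ᵐ[μ] L := by
  have := hH.isGaussianProcess.isProbabilityMeasure
  have hLH : L ∈ H := (Submodule.span_le.2 (by rintro _ ⟨j, rfl⟩; exact hY j)) hL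
  have hXL : X - L ∈ H := H.sub_mem hX hLH
  have hm0 : m ≤ (inferInstance : MeasurableSpace Ω) :=
    hm.trans (measurable_pi_lambda _ fun j => hH.measurable _ (hY j)).comap_le
  have hLm : Measurable[m] L := by
    clear h0 hXL hLH
    induction hL using Submodule.span_induction with
    | mem x h => obtain ⟨j, rfl⟩ := h; exact hYm j
    | zero => exact measurable_const
    | add x y _ _ hx hy => exact hx.add hy
    | smul a x _ hx => exact hx.const_smul a
  -- `indepFun` speaks of families, so the residual enters as a family indexed by `Unit`.
  have hind : IndepFun (X - L) (fun ω j => Y j ω) μ :=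
    (hH.indepFun (X := fun ω (_ : Unit) => (X - L) ω) (Y := fun ω j => Y j ω)
      (fun _ => hXL) hY (fun _ j => h0 j)).comp (measurable_pi_apply ()) measurable_id
  have hres : μ[X - L | m] =ᵐ[μ] fun _ => 0 := by
    have := condExp_indep_eq (hH.measurable _ hXL).comap_le hm0
      (comap_measurable (X - L)).stronglyMeasurable
      (indep_of_indep_of_le_right ((IndepFun_iff_Indep _ _ _).1 hind) hm)
    rwa [hH.integral_eq_zero _ hXL] at this
  -- In `X = (X - L) + L` the first term is centered and independent of `m`, the second is
  -- `m`-measurable.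
  have hadd := condExp_add (hH.integrable hXL) (hH.integrable hLH) m
  rw [sub_add_cancel, condExp_of_stronglyMeasurable hm0 hLm.stronglyMeasurable
    (hH.integrable hLH)] at hadd
  filter_upwards [hadd, hres] with ω h1 h2
  rw [h1, Pi.add_apply, h2, zero_add]

/-- Best linear estimates exist. -/
theorem exists_linear_estimate (hH : IsCenteredGaussianSpace H μ) {κ : Type*} [Finite κ]
    {Y : κ → Ω → ℝ} (hY : ∀ j, Y j ∈ H) {X : Ω → ℝ} (hX : X ∈ H) :
    ∃ L ∈ Submodule.span ℝ (Set.range Y), ∀ j, ∫ ω, (X ω - L ω) * Y j ω ∂μ = 0 := by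
  cases nonempty_fintype κ
  -- The orthogonal projection is taken among classes in `L²`; its coefficients `c` then define a
  -- genuine function in the span of `Y`.
  let y : κ → Lp ℝ 2 μ := fun j => (hH.memLp (hY j)).toLp (Y j)
  let K : Submodule ℝ (Lp ℝ 2 μ) := Submodule.span ℝ (Set.range y)
  have : FiniteDimensional ℝ K := FiniteDimensional.span_of_finite ℝ (Set.finite_range y)
  let ξ : Lp ℝ 2 μ := (hH.memLp hX).toLp X
  obtain ⟨c, hc⟩ := (Submodule.mem_span_range_iff_exists_fun ℝ).1 (K.orthogonalProjectionOnto ξ).2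
  refine ⟨∑ j, c j • Y j, (Submodule.mem_span_range_iff_exists_fun ℝ).2 ⟨c, rfl⟩, fun j => ?_⟩
  have hL : ∑ j, c j • Y j ∈ H := H.sum_mem fun j _ => H.smul_mem _ (hY j)
  have h0 : inner ℝ (ξ - K.orthogonalProjectionOnto ξ) (y j) = 0 :=
    K.sub_starProjection_mem_orthogonal ξ |> fun h =>
      (Submodule.mem_orthogonal' K _).1 h (y j) (Submodule.subset_span ⟨j, rfl⟩)
  rw [← hc, L2.inner_def] at h0
  rw [← h0]
  have hsum : (∑ j, c j • y j : Lp ℝ 2 μ) = (hH.memLp hL).toLp _ := by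
    refine Lp.ext ?_
    have hs : ∀ s : Finset κ, (∑ j ∈ s, c j • y j : Lp ℝ 2 μ) =ᵐ[μ] ∑ j ∈ s, c j • Y j := by
      classical
      intro s
      induction s using Finset.induction_on with
      | empty => simpa using Lp.coeFn_zero ℝ 2 μ
      | insert a s ha ih =>
        rw [Finset.sum_insert ha, Finset.sum_insert ha]
        exact (Lp.coeFn_add _ _).trans (((Lp.coeFn_smul _ _).trans
          ((hH.memLp (hY a)).coeFn_toLp.const_smul (c a))).add ih)
    exact (hs _).trans (hH.memLp hL).coeFn_toLp.symm
  rw [hsum]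
  refine integral_congr_ae ?_
  filter_upwards [Lp.coeFn_sub ξ ((hH.memLp hL).toLp _), (hH.memLp hX).coeFn_toLp,
    (hH.memLp (hY j)).coeFn_toLp, (hH.memLp hL).coeFn_toLp] with ω h1 h2 h3 h4
  simp only [RCLike.inner_apply, conj_trivial]
  rw [h1, Pi.sub_apply, h2, h3, h4, mul_comm]

variable {I J J' : Type*}

theorem crossCov_add_left (hH : IsCenteredGaussianSpace H μ) {X X' : Ω → I → ℝ} {Y : Ω → J → ℝ}
    (hX : ∀ a, (fun ω => X ω a) ∈ H) (hX' : ∀ a, (fun ω => X' ω a) ∈ H)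
    (hY : ∀ b, (fun ω => Y ω b) ∈ H) :
    crossCov μ (fun ω => X ω + X' ω) Y = crossCov μ X Y + crossCov μ X' Y := by
  ext a b
  simp only [crossCov, Matrix.of_apply, Pi.add_apply, add_mul, Matrix.add_apply]
  exact integral_add (hH.integrable_mul (hX a) (hY b)) (hH.integrable_mul (hX' a) (hY b))

theorem crossCov_sub_left (hH : IsCenteredGaussianSpace H μ) {X X' : Ω → I → ℝ} {Y : Ω → J → ℝ}
    (hX : ∀ a, (fun ω => X ω a) ∈ H) (hX' : ∀ a, (fun ω => X' ω a) ∈ H)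
    (hY : ∀ b, (fun ω => Y ω b) ∈ H) :
    crossCov μ (fun ω => X ω - X' ω) Y = crossCov μ X Y - crossCov μ X' Y := by
  ext a b
  simp only [crossCov, Matrix.of_apply, Pi.sub_apply, sub_mul, Matrix.sub_apply]
  exact integral_sub (hH.integrable_mul (hX a) (hY b)) (hH.integrable_mul (hX' a) (hY b))

theorem crossCov_mulVec_left [Fintype I] (hH : IsCenteredGaussianSpace H μ) (M : Matrix J' I ℝ)
    {X : Ω → I → ℝ} {Y : Ω → J → ℝ} (hX : ∀ a, (fun ω => X ω a) ∈ H)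
    (hY : ∀ b, (fun ω => Y ω b) ∈ H) :
    crossCov μ (fun ω => M *ᵥ X ω) Y = M * crossCov μ X Y := by
  ext a b
  simp only [crossCov, Matrix.of_apply, Matrix.mulVec, dotProduct, Finset.sum_mul, Matrix.mul_apply,
    mul_assoc]
  rw [integral_finsetSum _ fun i _ => (hH.integrable_mul (hX i) (hY b)).const_mul _]
  simp only [integral_const_mul]

theorem crossCov_add_right (hH : IsCenteredGaussianSpace H μ) {X : Ω → I → ℝ} {Y Y' : Ω → J → ℝ}
    (hX : ∀ a, (fun ω => X ω a) ∈ H) (hY : ∀ b, (fun ω => Y ω b) ∈ H)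
    (hY' : ∀ b, (fun ω => Y' ω b) ∈ H) :
    crossCov μ X (fun ω => Y ω + Y' ω) = crossCov μ X Y + crossCov μ X Y' := by
  rw [← crossCov_transpose, hH.crossCov_add_left hY hY' hX, Matrix.transpose_add,
    crossCov_transpose, crossCov_transpose]

theorem crossCov_mulVec_right [Fintype J] (hH : IsCenteredGaussianSpace H μ) (M : Matrix J' J ℝ)
    {X : Ω → I → ℝ} {Y : Ω → J → ℝ} (hX : ∀ a, (fun ω => X ω a) ∈ H)
    (hY : ∀ b, (fun ω => Y ω b) ∈ H) :
    crossCov μ X (fun ω => M *ᵥ Y ω) = crossCov μ X Y * Mᵀ := by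
  rw [← crossCov_transpose, hH.crossCov_mulVec_left M hY hX, Matrix.transpose_mul,
    crossCov_transpose]

/-- The quadratic form at `c` is the second moment of `∑ a, c a * X a`. -/
theorem crossCov_self_posSemidef [Fintype I] (hH : IsCenteredGaussianSpace H μ) {X : Ω → I → ℝ}
    (hX : ∀ a, (fun ω => X ω a) ∈ H) : (crossCov μ X X).PosSemidef := by
  refine Matrix.PosSemidef.of_dotProduct_mulVec_nonneg ?_ fun c => ?_
  · rw [Matrix.IsHermitian, Matrix.conjTranspose_eq_transpose_of_trivial, crossCov_transpose]
  · have h : c ⬝ᵥ crossCov μ X X *ᵥ c = ∫ ω, (∑ a, c a * X ω a) * ∑ a, c a * X ω a ∂μ := by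
      simp only [Finset.sum_mul_sum, dotProduct, Matrix.mulVec, crossCov, Matrix.of_apply]
      have hi : ∀ a b, Integrable (fun ω => c a * X ω a * (c b * X ω b)) μ := fun a b =>
        hH.integrable_mul (H.smul_mem (c a) (hX a)) (H.smul_mem (c b) (hX b))
      rw [integral_finsetSum _ fun a _ => integrable_finsetSum _ fun b _ => hi a b]
      refine Finset.sum_congr rfl fun a _ => ?_
      rw [integral_finsetSum _ fun b _ => hi a b, Finset.mul_sum]
      refine Finset.sum_congr rfl fun b _ => ?_
      rw [mul_comm (∫ ω, _ ∂μ), ← integral_const_mul, ← integral_const_mul]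
      exact integral_congr_ae (.of_forall fun ω => by ring)
    rw [star_trivial, h]
    exact integral_nonneg fun ω => mul_self_nonneg _

end IsCenteredGaussianSpace

end Gaussian

/-! ### Sparsity patterns and the normal equations of the local gain. -/

namespace ThreePlayer

variable {Ω : Type*} {n q p : Fin 3 → ℕ}

theorem self_mem_S (i : Fin 3) : i ∈ S i := by
  fin_cases i <;> simp [S]

theorem IsBlockDiag.isSparse {r c : Fin 3 → ℕ} {M : Matrix (Idx r) (Idx c) ℝ}
    (hM : IsBlockDiag M) : IsSparse M :=
  fun a b hb => hM a b fun he => hb (he ▸ self_mem_S _)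

theorem IsBlockDiag.mul {r c d : Fin 3 → ℕ} {M : Matrix (Idx r) (Idx c) ℝ}
    {N : Matrix (Idx c) (Idx d) ℝ} (hM : IsBlockDiag M) (hN : IsBlockDiag N) :
    IsBlockDiag (M * N) := by
  intro a b hab
  rw [Matrix.mul_apply]
  refine Finset.sum_eq_zero fun c _ => ?_
  by_cases hc : c.1 = a.1
  · rw [hN c b (hc ▸ hab), mul_zero]
  · rw [hM a c hc, zero_mul]

theorem IsSparse.add {r c : Fin 3 → ℕ} {M N : Matrix (Idx r) (Idx c) ℝ}
    (hM : IsSparse M) (hN : IsSparse N) : IsSparse (M + N) := by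
  intro a b hab
  rw [Matrix.add_apply, hM a b hab, hN a b hab, add_zero]

/-- A sum over all indices whose terms vanish outside the blocks of `S i`. -/
theorem sum_eq_sum_NIdx {d : Fin 3 → ℕ} (i : Fin 3) {f : Idx d → ℝ}
    (hf : ∀ b, b.1 ∉ S i → f b = 0) : ∑ b, f b = ∑ b : NIdx d i, f b := by
  have h0 : ∑ b : {b : Idx d // b.1 ∉ S i}, f b = 0 := Finset.sum_eq_zero fun b _ => hf b b.2
  rw [← Fintype.sum_subtype_add_sum_subtype (fun b : Idx d => b.1 ∈ S i) f, h0, add_zero]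

/-- Row `b` of `C` lives in the block of `b`, which belongs to `S i`, so the columns of `Q` outside
`S i` do not contribute. -/
theorem IsBlockDiag.mul_transpose_submatrix {r c : Fin 3 → ℕ} {J : Type*}
    {C : Matrix (Idx r) (Idx c) ℝ} (hC : IsBlockDiag C) (i : Fin 3) (Q : Matrix J (Idx c) ℝ)
    (a : J) (b : NIdx r i) :
    (Q * Cᵀ) a b = ((Q.submatrix id Subtype.val : Matrix J (NIdx c i) ℝ) *
      (C.submatrix Subtype.val Subtype.val : Matrix (NIdx r i) (NIdx c i) ℝ)ᵀ) a b := by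
  rw [Matrix.mul_apply, Matrix.mul_apply, sum_eq_sum_NIdx i]
  · rfl
  · intro c hc
    rw [Matrix.transpose_apply, hC b c fun he => hc (he ▸ b.2), mul_zero]

/-- The gain solves the normal equations of the local estimation problems. -/
theorem gainRow_normal_equation (sys : Plant n q p) {P : Matrix (Idx n) (Idx n) ℝ}
    (hP : P.PosSemidef) {K : Matrix (Idx n) (Idx p) ℝ}
    (hK : ∀ a b, K a b = if h : b.1 ∈ S a.1 then gainRow sys P a.1 a.2 ⟨b, h⟩ else 0)
    (a : Idx n) (b : Idx p) (hb : b.1 ∈ S a.1) :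
    (K * (sys.C * P * sys.Cᵀ + sys.V)) a b = (sys.A * P * sys.Cᵀ) a b := by
  obtain ⟨i, r⟩ := a
  set Cs : Matrix (NIdx p i) (NIdx n i) ℝ := sys.C.submatrix Subtype.val Subtype.val with hCs
  set Ps : Matrix (NIdx n i) (NIdx n i) ℝ := P.submatrix Subtype.val Subtype.val with hPs
  set Vs : Matrix (NIdx p i) (NIdx p i) ℝ := sys.V.submatrix Subtype.val Subtype.val with hVs
  -- A positive semidefinite matrix plus the positive definite `Vs` is invertible.
  have hunit : IsUnit (Cs * Ps * Csᵀ + Vs).det := by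
    have hV : Vs.PosDef := sys.posDef_V.submatrix Subtype.val_injective
    have hC : (Cs * Ps * Csᵀ).PosSemidef := by
      have := (hP.submatrix (Subtype.val : NIdx n i → _)).mul_mul_conjTranspose_same Cs
      rwa [Matrix.conjTranspose_eq_transpose_of_trivial] at this
    exact (Matrix.isUnit_iff_isUnit_det _).1 (hV.posSemidef_add hC).isUnit
  -- Block diagonality of `C` truncates both sums in `C P Cᵀ` to `S i`.
  have hsub : ∀ b' b'' : NIdx p i, (sys.C * P * sys.Cᵀ + sys.V) b' b'' =
      (Cs * Ps * Csᵀ + Vs) b' b'' := by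
    intro b' b''
    rw [Matrix.add_apply, Matrix.add_apply, sys.diag_C.mul_transpose_submatrix i]
    congr 1
    rw [Matrix.mul_apply, Matrix.mul_apply]
    refine Finset.sum_congr rfl fun c _ => ?_
    congr 1
    rw [Matrix.submatrix_apply, Matrix.mul_apply, Matrix.mul_apply, sum_eq_sum_NIdx i]
    · rfl
    · intro c' hc'
      exact mul_eq_zero_of_left (sys.diag_C b' c' fun he => hc' (he ▸ b'.2)) _
  have hgain : gainRow sys P i * (Cs * Ps * Csᵀ + Vs) =
      sys.A.submatrix (fun r => ⟨i, r⟩) id * P.submatrix id Subtype.val * Csᵀ := by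
    exact Matrix.nonsing_inv_mul_cancel_right _ _ hunit
  rw [Matrix.mul_apply, sum_eq_sum_NIdx i]
  · have := congrFun (congrFun hgain r) ⟨b, hb⟩
    rw [Matrix.mul_apply] at this
    refine Eq.trans (Finset.sum_congr rfl fun b' _ => ?_) (this.trans ?_)
    · rw [hsub b' ⟨b, hb⟩, hK, dif_pos b'.2]
    · exact (sys.diag_C.mul_transpose_submatrix i (sys.A * P) ⟨i, r⟩ ⟨b, hb⟩).symm
  · intro b' hb'
    rw [hK, dif_neg hb', zero_mul]

/-! ### Linear spans of the noises and of the measurements. -/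

section Membership

variable {N : Submodule ℝ (Ω → ℝ)}

/-- Only the nonzero entries of the row matter; this turns sparsity of a gain into locality of the
information it uses. -/
theorem mulVec_mem_of_row {I J : Type*} [Fintype J] {M : Matrix I J ℝ} {X : Ω → J → ℝ} {a : I}
    (hX : ∀ b, M a b ≠ 0 → (fun ω => X ω b) ∈ N) : (fun ω => (M *ᵥ X ω) a) ∈ N := by
  have : (fun ω => (M *ᵥ X ω) a) = ∑ b, M a b • fun ω => X ω b := by
    ext ω
    simp [Matrix.mulVec, dotProduct]
  rw [this]
  refine N.sum_mem fun b _ => ?_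
  by_cases hb : M a b = 0
  · rw [hb, zero_smul]; exact N.zero_mem
  · exact N.smul_mem _ (hX b hb)

theorem mulVec_mem {I J : Type*} [Fintype J] (M : Matrix I J ℝ) {X : Ω → J → ℝ}
    (hX : ∀ b, (fun ω => X ω b) ∈ N) (a : I) : (fun ω => (M *ᵥ X ω) a) ∈ N :=
  mulVec_mem_of_row fun b _ => hX b

theorem linearMap_mem {I J T : Type*} [Fintype J] [Fintype T]
    (f : (T → J → ℝ) →ₗ[ℝ] (I → ℝ)) {Y : T → Ω → J → ℝ}
    (hY : ∀ t b, (fun ω => Y t ω b) ∈ N) (a : I) : (fun ω => f (fun t => Y t ω) a) ∈ N := by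
  classical
  have : (fun ω => f (fun t => Y t ω) a) =
      ∑ t, ∑ b, f (Pi.single t (Pi.single b 1)) a • fun ω => Y t ω b := by
    ext ω
    -- Expansion in the standard basis exhibits the coefficients of `f`.
    have h1 : (fun t => Y t ω) = ∑ t, ∑ b, Y t ω b • Pi.single t (Pi.single b (1 : ℝ)) := by
      ext t b
      simp [Finset.sum_apply, Pi.single_apply, apply_ite, ite_apply]
    rw [h1]
    simp [map_sum, Finset.sum_apply, mul_comm]
  rw [this]
  exact N.sum_mem fun t _ => N.sum_mem fun b _ => N.smul_mem _ (hY t b)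

/-- The linear span of `x(0)` and of the noises before time `k`. -/
def drivingSpan (x₀ : Ω → Idx n → ℝ) (w : ℕ → Ω → Idx n → ℝ) (v : ℕ → Ω → Idx p → ℝ) (k : ℕ) :
    Submodule ℝ (Ω → ℝ) :=
  Submodule.span ℝ {X | (∃ a, X = fun ω => x₀ ω a) ∨ (∃ t < k, ∃ a, X = fun ω => w t ω a) ∨
    ∃ t < k, ∃ b, X = fun ω => v t ω b}

/-- The measurements `y(0), …, y(k-1)` as one family of random variables. -/
def pastFamily (y : ℕ → Ω → Idx p → ℝ) (k : ℕ) : Fin k × Idx p → Ω → ℝ :=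
  fun j ω => y j.1 ω j.2

/-- The linear span of the measurements `y(0), …, y(k-1)`. -/
def pastSpan (y : ℕ → Ω → Idx p → ℝ) (k : ℕ) : Submodule ℝ (Ω → ℝ) :=
  Submodule.span ℝ (Set.range (pastFamily y k))

theorem mem_pastSpan (y : ℕ → Ω → Idx p → ℝ) {k t : ℕ} (ht : t < k) (b : Idx p) :
    (fun ω => y t ω b) ∈ pastSpan y k :=
  Submodule.subset_span ⟨(⟨t, ht⟩, b), rfl⟩

theorem delay_mem_pastSpan (y : ℕ → Ω → Idx p → ℝ) (k : ℕ) (b : Idx p) :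
    (fun ω => delay y k ω b) ∈ pastSpan y k := by
  cases k with
  | zero => exact Submodule.zero_mem _
  | succ k => exact mem_pastSpan y k.lt_succ_self b

theorem drivingSpan_mono (x₀ : Ω → Idx n → ℝ) (w : ℕ → Ω → Idx n → ℝ) (v : ℕ → Ω → Idx p → ℝ)
    {k l : ℕ} (hkl : k ≤ l) : drivingSpan x₀ w v k ≤ drivingSpan x₀ w v l := by
  refine Submodule.span_mono ?_
  rintro X (h | ⟨t, ht, h⟩ | ⟨t, ht, h⟩)
  exacts [.inl h, .inr (.inl ⟨t, ht.trans_le hkl, h⟩), .inr (.inr ⟨t, ht.trans_le hkl, h⟩)]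

theorem drivingSpan_le (x₀ : Ω → Idx n → ℝ) (w : ℕ → Ω → Idx n → ℝ) (v : ℕ → Ω → Idx p → ℝ)
    (k : ℕ) : drivingSpan x₀ w v k ≤ Submodule.span ℝ (Set.range (primitives x₀ w v)) := by
  refine Submodule.span_mono ?_
  rintro X (⟨a, rfl⟩ | ⟨t, ht, a, rfl⟩ | ⟨t, ht, a, rfl⟩)
  exacts [⟨.inl a, rfl⟩, ⟨.inr (.inl (t, a)), rfl⟩, ⟨.inr (.inr (t, a)), rfl⟩]

theorem noise_mem_drivingSpan (w : ℕ → Ω → Idx n → ℝ) (v : ℕ → Ω → Idx p → ℝ) (x₀ : Ω → Idx n → ℝ)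
    {t k : ℕ} (ht : t < k) : (∀ a, (fun ω => w t ω a) ∈ drivingSpan x₀ w v k) ∧
      ∀ b, (fun ω => v t ω b) ∈ drivingSpan x₀ w v k :=
  ⟨fun a => Submodule.subset_span (.inr (.inl ⟨t, ht, a, rfl⟩)),
    fun b => Submodule.subset_span (.inr (.inr ⟨t, ht, b, rfl⟩))⟩

end Membership

/-! ### σ-algebras of measurements and coordinatewise conditional expectation. -/

section Measurability

/-- The family `Z` may contain more than the past measurements, so the bound also serves the local
σ-algebras. -/
theorem past_le_comap (y : ℕ → Ω → Idx p → ℝ) {k : ℕ} {κ : Type*} {Z : κ → Ω → ℝ}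
    (hZ : ∀ t < k, ∀ b, ∃ j, (fun ω => y t ω b) = Z j) :
    past y k ≤ MeasurableSpace.comap (fun ω j => Z j ω) MeasurableSpace.pi := by
  let _ : MeasurableSpace Ω := MeasurableSpace.comap (fun ω j => Z j ω) MeasurableSpace.pi
  refine iSup₂_le fun t ht => Measurable.comap_le (measurable_pi_iff.2 fun b => ?_)
  obtain ⟨j, hj⟩ := hZ t ht b
  rw [hj]
  exact (measurable_pi_apply j).comp (comap_measurable fun ω j => Z j ω)

theorem measurable_past (y : ℕ → Ω → Idx p → ℝ) {k t : ℕ} (ht : t < k) :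
    Measurable[past y k] (y t) :=
  Measurable.of_comap_le (le_iSup₂_of_le t ht le_rfl)

theorem condExp_pi_apply_ae_eq {m : MeasurableSpace Ω} [MeasurableSpace Ω] {I : Type*} [Fintype I]
    {μ : Measure Ω}
    {X : Ω → I → ℝ} (hX : Integrable X μ) (a : I) :
    (fun ω => (μ[X | m]) ω a) =ᵐ[μ] μ[fun ω => X ω a | m] :=
  (ContinuousLinearMap.proj (R := ℝ) (φ := fun _ : I => ℝ) a).comp_condExp_comm hX

end Measurability

end ThreePlayer

/-! ### The closed loop: causality, whiteness of the noises, linear versions of the estimates. -/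

namespace ThreePlayer

variable {Ω : Type*} [MeasurableSpace Ω] {μ : Measure Ω} {n q p : Fin 3 → ℕ} {sys : Plant n q p}
  {Γ : Controller q p} {x : ℕ → Ω → Idx n → ℝ} {u : ℕ → Ω → Idx q → ℝ} {y : ℕ → Ω → Idx p → ℝ}
  {w : ℕ → Ω → Idx n → ℝ} {v : ℕ → Ω → Idx p → ℝ}

namespace IsClosedLoop

theorem isCenteredGaussianSpace (h : IsClosedLoop μ sys Γ x u y w v) :
    IsCenteredGaussianSpace (Submodule.span ℝ (Set.range (primitives (x 0) w v))) μ := by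
  refine .span_range h.gaussian ?_ h.mean_zero
  rintro (a | ⟨k, a⟩ | ⟨k, b⟩)
  exacts [(measurable_pi_apply a).comp h.measurable_x₀,
    (measurable_pi_apply a).comp (h.measurable_w k), (measurable_pi_apply b).comp (h.measurable_v k)]

/-- The index rises by one because `y(k)` contains `v(k)`, while `x(k)` involves only noises before
time `k`. -/
theorem output_mem_of_state_mem (h : IsClosedLoop μ sys Γ x u y w v) {k : ℕ}
    (hx : ∀ a, (fun ω => x k ω a) ∈ drivingSpan (x 0) w v k) (b : Idx p) :
    (fun ω => y k ω b) ∈ drivingSpan (x 0) w v (k + 1) := by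
  simp only [h.output]
  exact Submodule.add_mem _ (mulVec_mem _ (fun a => drivingSpan_mono _ _ _ k.le_succ (hx a)) b)
    ((noise_mem_drivingSpan w v (x 0) k.lt_succ_self).2 b)

/-- The closed loop is causal. -/
theorem state_output_mem_drivingSpan (h : IsClosedLoop μ sys Γ x u y w v) (k : ℕ) :
    (∀ a, (fun ω => x k ω a) ∈ drivingSpan (x 0) w v k) ∧
      ∀ t < k, ∀ b, (fun ω => y t ω b) ∈ drivingSpan (x 0) w v k := by
  induction k with
  | zero => exact ⟨fun a => Submodule.subset_span (.inl ⟨a, rfl⟩), fun t ht => by omega⟩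
  | succ k ih =>
    have hy : ∀ t < k + 1, ∀ b, (fun ω => y t ω b) ∈ drivingSpan (x 0) w v (k + 1) := by
      intro t ht b
      rcases Nat.lt_succ_iff_lt_or_eq.1 ht with ht | rfl
      · exact drivingSpan_mono _ _ _ k.le_succ (ih.2 t ht b)
      · exact h.output_mem_of_state_mem ih.1 b
    have hpast : pastSpan y (k + 1) ≤ drivingSpan (x 0) w v (k + 1) := by
      refine Submodule.span_le.2 ?_
      rintro _ ⟨⟨t, b⟩, rfl⟩
      exact hy t t.2 b
    have hpast' : pastSpan y k ≤ drivingSpan (x 0) w v (k + 1) := by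
      refine Submodule.span_le.2 ?_
      rintro _ ⟨⟨t, b⟩, rfl⟩
      exact hy t (t.2.trans k.lt_succ_self) b
    refine ⟨fun a => ?_, hy⟩
    have hu : ∀ c, (fun ω => u k ω c) ∈ drivingSpan (x 0) w v (k + 1) := by
      intro c
      simp only [h.control]
      refine Submodule.add_mem _ (Submodule.add_mem _ (mulVec_mem _ (hy k k.lt_succ_self) c)
        (mulVec_mem _ (fun b => hpast' (delay_mem_pastSpan y k b)) c)) ?_
      exact linearMap_mem (Γ.f k) (Y := fun j : Fin (k - 1) => y j)
        (fun j b => hy j (by have := j.2; omega) b) c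
    simp only [h.state]
    exact Submodule.add_mem _ (Submodule.add_mem _
      (mulVec_mem _ (fun a => drivingSpan_mono _ _ _ k.le_succ (ih.1 a)) a) (mulVec_mem _ hu a))
      ((noise_mem_drivingSpan w v (x 0) k.lt_succ_self).1 a)

theorem pastSpan_le_drivingSpan (h : IsClosedLoop μ sys Γ x u y w v) (k : ℕ) :
    pastSpan y k ≤ drivingSpan (x 0) w v k := by
  refine Submodule.span_le.2 ?_
  rintro _ ⟨⟨t, b⟩, rfl⟩
  exact (h.state_output_mem_drivingSpan k).2 t t.2 b

theorem state_mem (h : IsClosedLoop μ sys Γ x u y w v) (k : ℕ) (a : Idx n) :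
    (fun ω => x k ω a) ∈ Submodule.span ℝ (Set.range (primitives (x 0) w v)) :=
  drivingSpan_le _ _ _ k ((h.state_output_mem_drivingSpan k).1 a)

theorem output_mem (h : IsClosedLoop μ sys Γ x u y w v) (k : ℕ) (b : Idx p) :
    (fun ω => y k ω b) ∈ Submodule.span ℝ (Set.range (primitives (x 0) w v)) :=
  drivingSpan_le _ _ _ (k + 1) ((h.state_output_mem_drivingSpan (k + 1)).2 k k.lt_succ_self b)

theorem pastFamily_mem (h : IsClosedLoop μ sys Γ x u y w v) {k : ℕ} (j : Fin k × Idx p) :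
    pastFamily y k j ∈ Submodule.span ℝ (Set.range (primitives (x 0) w v)) :=
  h.output_mem _ _

/-- The noises from time `k` on are uncorrelated with everything that drives the system before. -/
theorem integral_noise_mul_eq_zero (h : IsClosedLoop μ sys Γ x u y w v) {k : ℕ} {X : Ω → ℝ}
    (hX : X ∈ drivingSpan (x 0) w v k) :
    (∀ a, ∫ ω, w k ω a * X ω ∂μ = 0) ∧ ∀ b, ∫ ω, v k ω b * X ω ∂μ = 0 := by
  have hsub := Submodule.span_le.1 (drivingSpan_le (x 0) w v k)
  refine ⟨fun a => h.isCenteredGaussianSpace.integral_mul_eq_zero_of_mem_span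
    (X := fun ω => w k ω a) (Submodule.subset_span ⟨.inr (.inl (k, a)), rfl⟩) hsub ?_ hX,
    fun b => h.isCenteredGaussianSpace.integral_mul_eq_zero_of_mem_span
    (X := fun ω => v k ω b) (Submodule.subset_span ⟨.inr (.inr (k, b)), rfl⟩) hsub ?_ hX⟩
  · rintro Y (⟨c, rfl⟩ | ⟨t, ht, c, rfl⟩ | ⟨t, ht, c, rfl⟩)
    · simpa only [mul_comm] using h.cov_x₀w k c a
    · rw [h.cov_w, if_neg ht.ne']
    · exact h.cov_wv k t a c
  · rintro Y (⟨c, rfl⟩ | ⟨t, ht, c, rfl⟩ | ⟨t, ht, c, rfl⟩)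
    · simpa only [mul_comm] using h.cov_x₀v k c b
    · simpa only [mul_comm] using h.cov_wv t k c b
    · rw [h.cov_v, if_neg ht.ne']

/-- A linear function of the past measurements whose error is uncorrelated with them is the
conditional expectation. -/
theorem condExp_past_ae_eq (h : IsClosedLoop μ sys Γ x u y w v) {k : ℕ} {I : Type*} [Fintype I]
    {X L : Ω → I → ℝ}
    (hX : ∀ a, (fun ω => X ω a) ∈ Submodule.span ℝ (Set.range (primitives (x 0) w v)))
    (hL : ∀ a, (fun ω => L ω a) ∈ pastSpan y k)
    (h0 : ∀ a j, ∫ ω, (X ω a - L ω a) * pastFamily y k j ω ∂μ = 0) :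
    μ[X | past y k] =ᵐ[μ] L := by
  have hH := h.isCenteredGaussianSpace
  have hint : Integrable X μ := .of_eval fun a => hH.integrable (hX a)
  have hcoord : ∀ a, μ[fun ω => X ω a | past y k] =ᵐ[μ] fun ω => L ω a := fun a =>
    hH.condExp_ae_eq (fun j => h.pastFamily_mem j) (hX a) (hL a) (h0 a)
      (fun j => (measurable_pi_apply j.2).comp (measurable_past y j.1.2))
      (past_le_comap y fun t ht b => ⟨(⟨t, ht⟩, b), rfl⟩)
  filter_upwards [ae_all_iff.2 hcoord, ae_all_iff.2 fun a =>
    condExp_pi_apply_ae_eq (m := past y k) hint a] with ω h1 h2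
  ext a
  rw [h2 a, h1 a]

/-- The one-step prediction is a linear function of the past measurements. -/
theorem exists_linear_pred (h : IsClosedLoop μ sys Γ x u y w v) (k : ℕ) :
    ∃ L : Ω → Idx n → ℝ, (∀ a, (fun ω => L ω a) ∈ pastSpan y k) ∧
      (∀ a j, ∫ ω, (x k ω a - L ω a) * pastFamily y k j ω ∂μ = 0) ∧
      pred μ x y k =ᵐ[μ] L := by
  choose L hL h0 using fun a => h.isCenteredGaussianSpace.exists_linear_estimate
    (fun j => h.pastFamily_mem (k := k) j) (h.state_mem k a)
  exact ⟨fun ω a => L a ω, hL, h0, h.condExp_past_ae_eq (h.state_mem k) hL h0⟩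

/-- Local estimates: the σ-algebra `info y i (k + 1)` is that of `y(0), …, y(k-1)` and the blocks in
`S i` of `y(k)`. -/
theorem localEst_succ_apply_ae_eq (h : IsClosedLoop μ sys Γ x u y w v) {k : ℕ} {a : Idx n}
    {L : Ω → ℝ} (hL : L ∈ Submodule.span ℝ (Set.range (Sum.elim (pastFamily y k)
      fun (b : NIdx p a.1) ω => y k ω b)))
    (h0 : ∀ j, ∫ ω, (x (k + 1) ω a - L ω) * pastFamily y k j ω ∂μ = 0)
    (h1 : ∀ b : Idx p, b.1 ∈ S a.1 → ∫ ω, (x (k + 1) ω a - L ω) * y k ω b ∂μ = 0) :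
    (fun ω => localEst μ x y (k + 1) ω a) =ᵐ[μ] L := by
  have hH := h.isCenteredGaussianSpace
  have hint : Integrable (fun ω => fun r : Fin (n a.1) => x (k + 1) ω ⟨a.1, r⟩) μ :=
    .of_eval fun r => hH.integrable (h.state_mem (k + 1) ⟨a.1, r⟩)
  refine (condExp_pi_apply_ae_eq (m := info y a.1 (k + 1)) hint a.2).trans ?_
  have hpast : past y k ≤ info y a.1 (k + 1) := le_sup_left
  refine hH.condExp_ae_eq (Y := Sum.elim (pastFamily y k) fun (b : NIdx p a.1) ω => y k ω b)
    ?_ (h.state_mem (k + 1) a) hL ?_ ?_ ?_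
  · rintro (j | b)
    exacts [h.pastFamily_mem j, h.output_mem k b]
  · rintro (j | b)
    exacts [h0 j, h1 b b.2]
  · rintro (j | ⟨⟨i, b⟩, hb⟩)
    · exact ((measurable_pi_apply j.2).comp (measurable_past y j.1.2)).mono hpast le_rfl
    · have : MeasurableSpace.comap (fun ω => fun b : Fin (p i) => y k ω ⟨i, b⟩) inferInstance ≤
          info y a.1 (k + 1) :=
        le_sup_of_le_right (le_iSup₂_of_le i hb (le_iSup₂_of_le k rfl le_rfl))
      exact ((measurable_pi_apply b).comp
        (comap_measurable fun ω => fun b : Fin (p i) => y k ω ⟨i, b⟩)).mono this le_rfl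
  · refine sup_le (past_le_comap y fun t ht b => ⟨.inl (⟨t, ht⟩, b), rfl⟩) ?_
    refine iSup₂_le fun i hi => iSup₂_le fun t ht => ?_
    -- The constraint `t + 1 = k + 1` in `info` leaves only the time `k`.
    obtain rfl : t = k := Nat.succ_injective ht
    let _ : MeasurableSpace Ω := MeasurableSpace.comap
      (fun ω j => Sum.elim (pastFamily y t) (fun (b : NIdx p a.1) ω => y t ω b) j ω)
      MeasurableSpace.pi
    refine Measurable.comap_le (measurable_pi_iff.2 fun b => ?_)
    exact (measurable_pi_apply (Sum.inr ⟨⟨i, b⟩, hi⟩)).comp (comap_measurable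
      fun ω j => Sum.elim (pastFamily y t) (fun (b : NIdx p a.1) ω => y t ω b) j ω)

end IsClosedLoop
end ThreePlayer

/-! ### The decomposition of the state into `x̂` and `x̃`. -/

namespace ThreePlayer

variable {Ω : Type*} [MeasurableSpace Ω] {μ : Measure Ω} {n q p : Fin 3 → ℕ} {sys : Plant n q p}
  {Γ : Controller q p} {x : ℕ → Ω → Idx n → ℝ} {u : ℕ → Ω → Idx q → ℝ} {y : ℕ → Ω → Idx p → ℝ}
  {w : ℕ → Ω → Idx n → ℝ} {v : ℕ → Ω → Idx p → ℝ}

namespace IsClosedLoop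

/-- A linear version of `x̂(k + 1)`, whose error is uncorrelated with the measurements and equals
`x̃(k + 1)`. -/
theorem exists_linear_xHat_succ (h : IsClosedLoop μ sys Γ x u y w v) (k : ℕ) :
    ∃ xh : Ω → Idx n → ℝ, (∀ a, (fun ω => xh ω a) ∈ pastSpan y k) ∧
      (∀ a j, ∫ ω, (x (k + 1) ω a - xh ω a) * pastFamily y k j ω ∂μ = 0) ∧
      xTilde sys Γ μ x y (k + 1) =ᵐ[μ] fun ω => x (k + 1) ω - xh ω := by
  have hH := h.isCenteredGaussianSpace
  set H := Submodule.span ℝ (Set.range (primitives (x 0) w v))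
  obtain ⟨ℓ, hℓ, hℓ0, hpred⟩ := h.exists_linear_pred k
  have hdH : drivingSpan (x 0) w v k ≤ H := drivingSpan_le _ _ _ k
  have hpd := h.pastSpan_le_drivingSpan k
  let e : Ω → Idx n → ℝ := fun ω => x k ω - ℓ ω
  let η : Ω → Idx p → ℝ := fun ω => y k ω - sys.C *ᵥ ℓ ω
  let Z : Ω → Fin k × Idx p → ℝ := fun ω j => pastFamily y k j ω
  let K := localGain sys μ x y k
  -- The dynamics with `x(k)`, `y(k)`, `w(k)` replaced by their predictions `ℓ`, `Cℓ`, `0`; the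
  -- remaining part of the control already depends on `y(0:k-1)` only.
  let xh : Ω → Idx n → ℝ := fun ω => sys.A *ᵥ ℓ ω + sys.B *ᵥ (Γ.F k *ᵥ (sys.C *ᵥ ℓ ω) +
    Γ.G k *ᵥ delay y k ω + Γ.f k (fun j : Fin (k - 1) => y j ω))
  have hη : η = fun ω => sys.C *ᵥ e ω + v k ω := by
    ext1 ω
    simp only [η, e, h.output, Matrix.mulVec_sub]
    abel
  have hxh : ∀ a, (fun ω => xh ω a) ∈ pastSpan y k := fun a =>
    Submodule.add_mem _ (mulVec_mem _ hℓ a) (mulVec_mem _ (fun c => Submodule.add_mem _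
      (Submodule.add_mem _ (mulVec_mem _ (mulVec_mem _ hℓ) c)
        (mulVec_mem _ (delay_mem_pastSpan y k) c))
      (linearMap_mem (Γ.f k) (Y := fun j : Fin (k - 1) => y j)
        (fun j b => mem_pastSpan y (by have := j.2; omega) b) c)) a)
  have hres : ∀ ω, x (k + 1) ω - xh ω =
      sys.A *ᵥ e ω + (sys.B * Γ.F k) *ᵥ η ω + w k ω := by
    intro ω
    simp only [xh, e, η, h.state, h.control, Matrix.mulVec_sub, Matrix.mulVec_add,
      ← Matrix.mulVec_mulVec]
    abel
  have hed : ∀ a, (fun ω => e ω a) ∈ drivingSpan (x 0) w v k := fun a =>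
    Submodule.sub_mem _ ((h.state_output_mem_drivingSpan k).1 a) (hpd (hℓ a))
  have he : ∀ a, (fun ω => e ω a) ∈ H := fun a => hdH (hed a)
  have hw : ∀ a, (fun ω => w k ω a) ∈ H := fun a => Submodule.subset_span ⟨.inr (.inl (k, a)), rfl⟩
  have hv : ∀ b, (fun ω => v k ω b) ∈ H := fun b => Submodule.subset_span ⟨.inr (.inr (k, b)), rfl⟩
  have hZ : ∀ j, (fun ω => Z ω j) ∈ H := fun j => h.pastFamily_mem j
  have hCe : ∀ b, (fun ω => (sys.C *ᵥ e ω) b) ∈ H := mulVec_mem _ he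
  have hηH : ∀ b, (fun ω => η ω b) ∈ H := fun b => by
    rw [hη]
    exact H.add_mem (hCe b) (hv b)
  have hAe : ∀ a, (fun ω => (sys.A *ᵥ e ω) a) ∈ H := mulVec_mem _ he
  have ceZ : crossCov μ e Z = 0 := Matrix.ext fun a j => hℓ0 a j
  have cwZ : crossCov μ (w k) Z = 0 := Matrix.ext fun a j =>
    (h.integral_noise_mul_eq_zero (hpd (Submodule.subset_span ⟨j, rfl⟩))).1 a
  have cvZ : crossCov μ (v k) Z = 0 := Matrix.ext fun b j =>
    (h.integral_noise_mul_eq_zero (hpd (Submodule.subset_span ⟨j, rfl⟩))).2 b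
  have cwe : crossCov μ (w k) e = 0 := Matrix.ext fun a c =>
    (h.integral_noise_mul_eq_zero (hed c)).1 a
  have cve : crossCov μ (v k) e = 0 := Matrix.ext fun b c =>
    (h.integral_noise_mul_eq_zero (hed c)).2 b
  have cev : crossCov μ e (v k) = 0 := by
    rw [← crossCov_transpose, cve, Matrix.transpose_zero]
  have cwv : crossCov μ (w k) (v k) = 0 := Matrix.ext fun a b => h.cov_wv k k a b
  have cvv : crossCov μ (v k) (v k) = sys.V := Matrix.ext fun a b => by
    simpa [crossCov] using h.cov_v k k a b
  have cηZ : crossCov μ η Z = 0 := by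
    rw [hη, hH.crossCov_add_left hCe hv hZ, hH.crossCov_mulVec_left _ he hZ, ceZ, cvZ, Matrix.mul_zero,
      add_zero]
  have ceη : crossCov μ e η = crossCov μ e e * sys.Cᵀ := by
    rw [hη, hH.crossCov_add_right he hCe hv, hH.crossCov_mulVec_right _ he he, cev, add_zero]
  have cvη : crossCov μ (v k) η = sys.V := by
    rw [hη, hH.crossCov_add_right hv hCe hv, hH.crossCov_mulVec_right _ hv he, cve, cvv, Matrix.zero_mul,
      zero_add]
  have cηη : crossCov μ η η = sys.C * crossCov μ e e * sys.Cᵀ + sys.V := by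
    have h1 : crossCov μ η η = crossCov μ (fun ω => sys.C *ᵥ e ω + v k ω) η :=
      congrArg (crossCov μ · η) hη
    rw [h1, hH.crossCov_add_left hCe hv hηH, hH.crossCov_mulVec_left _ he hηH, ceη, cvη,
      Matrix.mul_assoc]
  have cwη : crossCov μ (w k) η = 0 := by
    rw [hη, hH.crossCov_add_right hw hCe hv, hH.crossCov_mulVec_right _ hw he, cwe, cwv, Matrix.zero_mul,
      add_zero]
  have hP : errCov μ x y k = crossCov μ e e := by
    ext a b
    refine integral_congr_ae ?_
    filter_upwards [hpred] with ω hω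
    rw [hω]
    rfl
  -- This turns out to be the local error: `BFη` is absent because the local estimate reproduces it
  -- exactly.
  let ρ : Ω → Idx n → ℝ := fun ω => sys.A *ᵥ e ω + w k ω - K *ᵥ η ω
  have hAew : ∀ a, (fun ω => (sys.A *ᵥ e ω + w k ω) a) ∈ H := fun a => H.add_mem (hAe a) (hw a)
  have hρH : ∀ a, (fun ω => ρ ω a) ∈ H := fun a => H.sub_mem (hAew a) (mulVec_mem _ hηH a)
  have cρZ : crossCov μ ρ Z = 0 := by
    rw [hH.crossCov_sub_left hAew (mulVec_mem _ hηH) hZ, hH.crossCov_add_left hAe hw hZ,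
      hH.crossCov_mulVec_left _ he hZ, hH.crossCov_mulVec_left _ hηH hZ, ceZ, cwZ, cηZ]
    simp
  have cρη : crossCov μ ρ η = sys.A * crossCov μ e e * sys.Cᵀ -
      K * (sys.C * crossCov μ e e * sys.Cᵀ + sys.V) := by
    rw [hH.crossCov_sub_left hAew (mulVec_mem _ hηH) hηH, hH.crossCov_add_left hAe hw hηH,
      hH.crossCov_mulVec_left _ he hηH, hH.crossCov_mulVec_left _ hηH hηH, ceη, cwη, cηη, add_zero,
      ← Matrix.mul_assoc sys.A]
  have hρη : ∀ (a : Idx n) (b : Idx p), b.1 ∈ S a.1 → ∫ ω, ρ ω a * η ω b ∂μ = 0 := by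
    intro a b hb
    have hn := gainRow_normal_equation sys (hH.crossCov_self_posSemidef he) (K := K)
      (fun a b => by simp only [K, localGain, hP, Matrix.of_apply]) a b hb
    have := congrFun (congrFun cρη a) b
    rwa [Matrix.sub_apply, hn, sub_self] at this
  have hρy : ∀ (a : Idx n) (b : Idx p), b.1 ∈ S a.1 → ∫ ω, ρ ω a * y k ω b ∂μ = 0 := by
    intro a b hb
    have hCℓ : (fun ω => (sys.C *ᵥ ℓ ω) b) ∈ pastSpan y k := mulVec_mem _ hℓ b
    have h1 : ∫ ω, ρ ω a * (sys.C *ᵥ ℓ ω) b ∂μ = 0 := by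
      refine hH.integral_mul_eq_zero_of_mem_span (hρH a) ?_ ?_ hCℓ
      · rintro _ ⟨j, rfl⟩
        exact hZ j
      · rintro _ ⟨j, rfl⟩
        exact congrFun (congrFun cρZ a) j
    -- `y(k) = η + Cℓ`, and `Cℓ` is linear in the past, to which `ρ` is orthogonal.
    have h2 : ∀ ω, ρ ω a * y k ω b = ρ ω a * η ω b + ρ ω a * (sys.C *ᵥ ℓ ω) b := fun ω => by
      simp only [η, Pi.sub_apply]
      ring
    simp only [h2]
    rw [integral_add (hH.integrable_mul (hρH a) (hηH b))
      (hH.integrable_mul (hρH a) (hdH (hpd hCℓ))), hρη a b hb, h1, add_zero]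
  let M := sys.B * Γ.F k + K
  -- Sparsity makes row `a` of `M *ᵥ η` depend only on the blocks of `y(k)` in `S a.1` and on the
  -- past.
  have hM : IsSparse M := (sys.diag_B.mul (Γ.diag_F k)).isSparse.add fun a b hb => by
    simp only [K, localGain, Matrix.of_apply, dif_neg hb]
  have hxρ : ∀ ω, x (k + 1) ω - (xh ω + M *ᵥ η ω) = ρ ω := by
    intro ω
    rw [← sub_sub, hres]
    simp only [M, ρ, Matrix.add_mulVec]
    abel
  have hlocal : ∀ a, (fun ω => localEst μ x y (k + 1) ω a) =ᵐ[μ]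
      fun ω => (xh ω + M *ᵥ η ω) a := by
    intro a
    have hxρa : ∀ ω, x (k + 1) ω a - (xh ω + M *ᵥ η ω) a = ρ ω a := fun ω => by
      rw [← hxρ, Pi.sub_apply]
    have hle : pastSpan y k ≤ Submodule.span ℝ (Set.range (Sum.elim (pastFamily y k)
        fun (b : NIdx p a.1) ω => y k ω b)) := by
      refine Submodule.span_mono ?_
      rintro _ ⟨j, rfl⟩
      exact ⟨.inl j, rfl⟩
    refine h.localEst_succ_apply_ae_eq ?_ ?_ ?_
    · refine Submodule.add_mem _ (hle (hxh a)) (mulVec_mem_of_row fun b hb => ?_)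
      have hbS : b.1 ∈ S a.1 := by
        by_contra hc
        exact hb (hM a b hc)
      exact Submodule.sub_mem _ (Submodule.subset_span ⟨.inr ⟨b, hbS⟩, rfl⟩)
        (hle (mulVec_mem _ hℓ b))
    · intro j
      simp only [hxρa]
      exact congrFun (congrFun cρZ a) j
    · intro b hb
      simp only [hxρa]
      exact hρy a b hb
  refine ⟨xh, hxh, fun a j => ?_, ?_⟩
  · have hBF : ∀ a, (fun ω => ((sys.B * Γ.F k) *ᵥ η ω) a) ∈ H := mulVec_mem _ hηH
    have hABF : ∀ a, (fun ω => (sys.A *ᵥ e ω + (sys.B * Γ.F k) *ᵥ η ω) a) ∈ H := fun a =>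
      H.add_mem (hAe a) (hBF a)
    have : crossCov μ (fun ω => x (k + 1) ω - xh ω) Z = 0 := by
      simp only [hres]
      rw [hH.crossCov_add_left hABF hw hZ,
        hH.crossCov_add_left hAe hBF hZ, hH.crossCov_mulVec_left _ he hZ,
        hH.crossCov_mulVec_left _ hηH hZ, ceZ, cηZ, cwZ]
      simp
    exact congrFun (congrFun this a) j
  · filter_upwards [hpred, ae_all_iff.2 hlocal] with ω h1 h2
    have h3 : localEst μ x y (k + 1) ω = xh ω + M *ᵥ η ω := funext h2
    have h4 : innov sys μ x y k ω = η ω := by simp only [innov, η, h1]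
    simp only [xTilde, localErr, h3, h4]
    simp only [M, K]
    abel

/-- A linear version of `x̂(k)`, whose error is uncorrelated with the measurements and equals
`x̃(k)`. -/
theorem exists_linear_xHat (h : IsClosedLoop μ sys Γ x u y w v) (k : ℕ) :
    ∃ xh : Ω → Idx n → ℝ, (∀ a, (fun ω => xh ω a) ∈ pastSpan y (k - 1)) ∧
      (∀ a j, ∫ ω, (x k ω a - xh ω a) * pastFamily y (k - 1) j ω ∂μ = 0) ∧
      xTilde sys Γ μ x y k =ᵐ[μ] fun ω => x k ω - xh ω := by
  cases k with
  | succ k => exact h.exists_linear_xHat_succ k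
  | zero =>
    have hH := h.isCenteredGaussianSpace
    have := hH.isGaussianProcess.isProbabilityMeasure
    -- Since `0 - 1 = 0` in `ℕ`, there are no measurements; both estimates are the mean of `x(0)`,
    -- which is zero.
    refine ⟨0, fun a => Submodule.zero_mem _, fun a j => j.1.elim0, .of_forall fun ω => ?_⟩
    have hinfo : ∀ i, info y i 0 = ⊥ := fun i => by simp [info, past]
    have : localEst μ x y 0 ω = 0 := by
      ext a
      simp only [localEst, hinfo, condExp_bot]
      have hint : Integrable (fun ω => fun r : Fin (n a.1) => x 0 ω ⟨a.1, r⟩) μ :=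
        .of_eval fun r => hH.integrable (h.state_mem 0 ⟨a.1, r⟩)
      rw [eval_integral fun r => hint.eval r]
      exact h.mean_zero (.inl a)
    simp [xTilde, localErr, this]

end IsClosedLoop
end ThreePlayer

/-! ### Conclusion. -/

theorem lemma2 {Ω : Type*} [MeasurableSpace Ω] (μ : Measure Ω) [IsProbabilityMeasure μ]
    (n q p : Fin 3 → ℕ) (sys : ThreePlayer.Plant n q p) (Γ : ThreePlayer.Controller q p)
    (x : ℕ → Ω → ThreePlayer.Idx n → ℝ) (u : ℕ → Ω → ThreePlayer.Idx q → ℝ)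
    (y : ℕ → Ω → ThreePlayer.Idx p → ℝ)
    (w : ℕ → Ω → ThreePlayer.Idx n → ℝ) (v : ℕ → Ω → ThreePlayer.Idx p → ℝ)
    (h : ThreePlayer.IsClosedLoop μ sys Γ x u y w v) (k : ℕ) :
    MemLp (x k) 2 μ ∧
    (∀ᵐ ω ∂μ, x k ω = ThreePlayer.xTilde sys Γ μ x y k ω + ThreePlayer.xHat μ x y k ω) ∧
    IndepFun (ThreePlayer.xTilde sys Γ μ x y k) (ThreePlayer.xHat μ x y k) μ := by
  have hH := h.isCenteredGaussianSpace
  obtain ⟨xh, hxh, h0, hxt⟩ := h.exists_linear_xHat k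
  have hhat : ThreePlayer.xHat μ x y k =ᵐ[μ] xh := h.condExp_past_ae_eq (h.state_mem k) hxh h0
  have hxhH : ∀ a, (fun ω => xh ω a) ∈
      Submodule.span ℝ (Set.range (ThreePlayer.primitives (x 0) w v)) := fun a =>
    ThreePlayer.drivingSpan_le _ _ _ _ (h.pastSpan_le_drivingSpan (k - 1) (hxh a))
  refine ⟨.of_eval fun a => hH.memLp (h.state_mem k a), ?_, ?_⟩
  · filter_upwards [hxt, hhat] with ω h1 h2
    rw [h1, h2, sub_add_cancel]
  -- The conditional expectations agree with their linear versions only almost surely, which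
  -- suffices for independence.
  · refine IndepFun.congr (hH.indepFun (X := fun ω => x k ω - xh ω) (Y := xh)
      (fun a => Submodule.sub_mem _ (h.state_mem k a) (hxhH a)) hxhH fun a b => ?_)
      hxt.symm hhat.symm
    refine hH.integral_mul_eq_zero_of_mem_span (Submodule.sub_mem _ (h.state_mem k a) (hxhH a))
      ?_ ?_ (hxh b)
    · rintro _ ⟨j, rfl⟩
      exact h.pastFamily_mem j
    · rintro _ ⟨j, rfl⟩
      exact h0 a j
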